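/- \textbf{Theorem 1.} Let $\mathcal S$ be a finite set of schools and $A$ a finite set of at least two preparatory actions with a distinguished null action $a^0$ (every other action is deception). A student type is $\theta=(v,p^{manip},p^{exog})$ with utilities $v_s\in\mathbb R$, manipulable scores $p^{manip}_s(a)\in[0,1]$ and non-manipulable scores $p^{exog}_s\in[0,1]$ for $s\in\mathcal S$, $a\in A$. Fix the level of manipulability $w\in[0,1]$ and the cost of deception $\gamma>0$, and let the priority score be $p_{\theta,s}(a)=w\,p^{manip}_s(a)+(1-w)\,p^{exog}_s$. The students form a continuum of mass one with types distributed according to a Borel probability measure $\eta$ on the type space $\Theta=\mathbb R^{\mathcal S}\times[0,1]^{\mathcal S\times A}\times[0,1]^{\mathcal S}$. Assume that $\eta$ is atomless in the following sense: $\eta(v_s=v_{s'})=0$ for all $s\neq s'$, and $\eta(p_{\theta,s}(a)=x)=0$ for all $s$, $a$ and $x\in\mathbb R$. Given cutoffs $P\in(\mathbb R\cup\{-\infty\})^{\mathcal S}$, type $\theta$ can afford $s$ if $\max_a p_{\theta,s}(a)\ge P_s$. The net utility of an affordable school $s$ is $v_s$ if $p_{\theta,s}(a^0)\ge P_s$ (no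 deception needed) and $v_s-\gamma$ otherwise. The type demands its favourite affordable school in terms of net utility, provided that this net utility is positive; a tie between a school entered without and a school entered with deception is broken in favour of the former (any remaining tie between favourites, which has $\eta$-measure zero, leaves the type unmatched). Let $D_s(P)$ be the $\eta$-mass of types that demand $s$ at $P$. For capacities $C\in(0,\infty)^{\mathcal S}$, cutoffs $P$ are \emph{market clearing} (an equilibrium of the preference-revelation game) if $D_s(P)\le C_s$ for all $s$, with equality whenever $P_s>-\infty$. 1. If $\eta$ has full support in $\Theta$, then for every $C\in(0,\infty)^{\mathcal S}$ the economy $[\eta,C]$ has a unique equilibrium: market-clearing cutoffs exist, and any two of them coincide up to identifying all cutoffs in $[-\infty,0]$, each of which admits every student. 2. Suppose that $\eta$ is \emph{regular}: the image under $D:\mathbb R^{\mathcal S}\to\mathbb R^{\mathcal S}$ of the closure of the set of all $P\in\mathbb R^{\mathcal S}$ at which $D$ is not continuously differentiable has Lebesgue measure $0$. Then for Lebesgue-almost every $C\in(0,\infty)^{\mathcal S}$ with $\sum_{s}C_s<1$ there is exactly one vector of market-clearing cutoffs in $(\mathbb R\cup\{-\infty\})^{\mathcal S}$. -/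

import Mathlib

open MeasureTheory

noncomputable section

namespace Deception

/-- A student type: the utility `v s` of each school, the manipulable score component
`m s a ∈ [0,1]` at each school for each preparatory action, and the non-manipulable score
component `e s ∈ [0,1]` at each school. -/
abbrev StudentType (S A : Type*) : Type _ :=
  (S → ℝ) × (S → A → unitInterval) × (S → unitInterval)

variable {S A : Type*}

/-- Utility of being matched to `s`, before any cost of deception. -/
def utility (θ : StudentType S A) (s : S) : ℝ := θ.1 s

/-- Priority score at `s` after action `a`, when the level of manipulability is `w`. -/
def score (w : ℝ) (θ : StudentType S A) (s : S) (a : A) : ℝ :=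
  w * (θ.2.1 s a : ℝ) + (1 - w) * (θ.2.2 s : ℝ)

/-- Priority score at `s` after the entry-maximizing action. -/
def bestScore [Fintype A] [Nonempty A] (w : ℝ) (θ : StudentType S A) (s : S) : ℝ :=
  Finset.univ.sup' Finset.univ_nonempty (fun a : A => score w θ s a)

/-- Cutoffs: a real number or `-∞` (written `⊥`) for each school. -/
abbrev Cutoffs (S : Type*) : Type _ := S → WithBot ℝ

/-- The student can enter `s` with the null action `a₀`, that is, without deception. -/
def AffordsHonestly (a₀ : A) (w : ℝ) (P : Cutoffs S) (θ : StudentType S A) (s : S) : Prop :=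
  P s ≤ ((score w θ s a₀ : ℝ) : WithBot ℝ)

/-- The student can enter `s` with some action. -/
def Affords [Fintype A] [Nonempty A] (w : ℝ) (P : Cutoffs S) (θ : StudentType S A) (s : S) :
    Prop :=
  P s ≤ ((bestScore w θ s : ℝ) : WithBot ℝ)

open Classical in
/-- Net utility of entering an affordable school `s`: the cost `γ` is paid exactly when entry
requires deception. -/
def netUtility (a₀ : A) (w γ : ℝ) (P : Cutoffs S) (θ : StudentType S A) (s : S) : ℝ :=
  if AffordsHonestly a₀ w P θ s then utility θ s else utility θ s - γ

/-- Entering `s` is preferred to entering `s'` (both affordable): larger net utility or, if the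
net utilities are equal, `s` is entered without deception and `s'` with deception. -/
def Prefers (a₀ : A) (w γ : ℝ) (P : Cutoffs S) (θ : StudentType S A) (s s' : S) : Prop :=
  netUtility a₀ w γ P θ s' < netUtility a₀ w γ P θ s ∨
    (netUtility a₀ w γ P θ s' = netUtility a₀ w γ P θ s ∧
      AffordsHonestly a₀ w P θ s ∧ ¬ AffordsHonestly a₀ w P θ s')

/-- Type `θ` demands school `s` at cutoffs `P`: it is the favourite affordable school in terms of
net utility, and strictly better than being unmatched. -/
def Demands [Fintype A] [Nonempty A] (a₀ : A) (w γ : ℝ) (P : Cutoffs S)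
    (θ : StudentType S A) (s : S) : Prop :=
  Affords w P θ s ∧ 0 < netUtility a₀ w γ P θ s ∧
    ∀ s' : S, s' ≠ s → Affords w P θ s' → Prefers a₀ w γ P θ s s'

/-- Aggregate demand: the mass of students who demand `s` at cutoffs `P`. -/
def aggregateDemand [Fintype A] [Nonempty A] (a₀ : A) (w γ : ℝ)
    (η : Measure (StudentType S A)) (P : Cutoffs S) (s : S) : ℝ :=
  η.real {θ | Demands a₀ w γ P θ s}

/-- Market-clearing cutoffs for the capacities `C`. -/
def MarketClearing [Fintype A] [Nonempty A] (a₀ : A) (w γ : ℝ)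
    (η : Measure (StudentType S A)) (C : S → ℝ) (P : Cutoffs S) : Prop :=
  (∀ s, aggregateDemand a₀ w γ η P s ≤ C s) ∧
    ∀ s, ⊥ < P s → aggregateDemand a₀ w γ η P s = C s

/-- The type distribution has no mass at ties: almost no student is indifferent between two
schools, and the score at each school after each action has an atomless distribution. -/
def NoTies (w : ℝ) (η : Measure (StudentType S A)) : Prop :=
  (∀ s s' : S, s ≠ s' → η {θ | utility θ s = utility θ s'} = 0) ∧
    ∀ (s : S) (a : A) (x : ℝ), η {θ | score w θ s a = x} = 0

/-- Every nonempty open set of types has positive mass. -/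
def FullSupport (η : Measure (StudentType S A)) : Prop :=
  ∀ U : Set (StudentType S A), IsOpen U → U.Nonempty → 0 < η U

/-- Aggregate demand as a function of real cutoffs. -/
def demandMap [Fintype A] [Nonempty A] (a₀ : A) (w γ : ℝ)
    (η : Measure (StudentType S A)) (P : S → ℝ) : S → ℝ :=
  fun s => aggregateDemand a₀ w γ η (fun t => ((P t : ℝ) : WithBot ℝ)) s

/-- The type distribution is regular: the image under demand of the closure of the set of cutoffs
at which demand is not continuously differentiable is Lebesgue-null. -/
def Regular [Fintype S] [Fintype A] [Nonempty A] (a₀ : A) (w γ : ℝ)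
    (η : Measure (StudentType S A)) : Prop :=
  volume (demandMap a₀ w γ η ''
    closure {P : S → ℝ | ¬ ContDiffAt ℝ 1 (demandMap a₀ w γ η) P}) = 0

/-- Two cutoff vectors are the same up to values `≤ 0`: scores are at least `0`, so every cutoff
`≤ 0`, like `-∞`, means that every student can enter. -/
def SameCutoffs (P P' : Cutoffs S) : Prop :=
  ∀ s, P s = P' s ∨ (P s ≤ 0 ∧ P' s ≤ 0)

end Deception

end

/-!
Schools are gross substitutes. Raising cutoffs only removes options, and it makes the remaining ones
no better, so a type that demands `s` keeps demanding `s` while the cutoff of `s` is unchanged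
(`Demands.mono`), and, utilities having no ties, a type that is matched at higher cutoffs is matched
at lower ones (`sum_aggregateDemand_anti`). Since scores have no atoms, demand is a continuous
function of real cutoffs (`continuous_demandMap`). Both parts rest on these facts.

Existence (`exists_marketClearing`): among the cutoffs in `[0, 2]` without excess demand, a vector
with minimal sum clears the market, with `0` read as `⊥`.

Rural hospitals (`MarketClearing.aggregateDemand_sup`): if `P` and `P'` clear the market, each school
is demanded at `P ⊔ P'` at least as much as at `P`, while total demand is at most that at `P`; so
all demands agree. Under full support, raising a cutoff within the range of scores leaves an open set
of types unmatched and strictly lowers total demand, which gives uniqueness in the first part.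

Generic uniqueness (`ae_marketClearing_unique`): if `P < P'` both clear the market, let `U` be the
set of schools where they differ, and `R` the set of the other schools with cutoff above `⊥`. Cutoffs
between `P` and `P'` may be chosen rational on `U`, and they keep the demand for each school outside
`U`, and the total demand for `U`, at the values at `P`. So `C` lies in one of countably many sets
(`exactlyFilled`) in which only the cutoffs in `R` are free. In such a set, `∑ s ∈ U, C s` is a
`1`-Lipschitz function of the capacities in `R` (`sum_aggregateDemand_le`): only demand lost by `R`
can be gained elsewhere. Hence the set is Lebesgue-null. This bound takes the place of Sard's
theorem at the critical values of demand.
-/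

noncomputable section

namespace Deception

open Filter Topology Set

variable {S A : Type*}

/-! ### Demand of a single type -/

section Pointwise

variable {a₀ : A} {w γ : ℝ} {P P' : Cutoffs S} {θ : StudentType S A} {s t : S}

lemma score_nonneg (hw : w ∈ Icc (0 : ℝ) 1) (θ : StudentType S A) (s : S) (a : A) :
    0 ≤ score w θ s a :=
  add_nonneg (mul_nonneg hw.1 (θ.2.1 s a).2.1) (mul_nonneg (by linarith [hw.2]) (θ.2.2 s).2.1)

lemma score_le_one (hw : w ∈ Icc (0 : ℝ) 1) (θ : StudentType S A) (s : S) (a : A) :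
    score w θ s a ≤ 1 := by
  have h₁ := mul_le_mul_of_nonneg_left (θ.2.1 s a).2.2 hw.1
  have h₂ := mul_le_mul_of_nonneg_left (θ.2.2 s).2.2 (sub_nonneg.2 hw.2)
  unfold score
  linarith

lemma AffordsHonestly.anti (hP : P s ≤ P' s) (h : AffordsHonestly a₀ w P' θ s) :
    AffordsHonestly a₀ w P θ s :=
  hP.trans h

lemma netUtility_le (hγ : 0 ≤ γ) : netUtility a₀ w γ P θ s ≤ utility θ s := by
  unfold netUtility
  split_ifs <;> linarith

lemma le_netUtility (hγ : 0 ≤ γ) : utility θ s - γ ≤ netUtility a₀ w γ P θ s := by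
  unfold netUtility
  split_ifs <;> linarith

lemma netUtility_congr (h : AffordsHonestly a₀ w P θ s ↔ AffordsHonestly a₀ w P' θ s) :
    netUtility a₀ w γ P θ s = netUtility a₀ w γ P' θ s := by
  unfold netUtility
  by_cases hH : AffordsHonestly a₀ w P θ s
  · rw [if_pos hH, if_pos (h.1 hH)]
  · rw [if_neg hH, if_neg (mt h.2 hH)]

lemma netUtility_anti (hγ : 0 ≤ γ) (hP : P s ≤ P' s) :
    netUtility a₀ w γ P' θ s ≤ netUtility a₀ w γ P θ s := by
  by_cases h : AffordsHonestly a₀ w P' θ s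
  · exact (netUtility_congr (iff_of_true h (h.anti hP))).le
  · simpa only [netUtility, if_neg h] using le_netUtility (P := P) hγ

lemma Prefers.asymm (h : Prefers a₀ w γ P θ s t) : ¬ Prefers a₀ w γ P θ t s := by
  rintro (h' | ⟨h', h₁, h₂⟩) <;> rcases h with h | ⟨h, h₃, h₄⟩
  · exact lt_asymm h h'
  · exact h'.ne h.symm
  · exact h.ne h'.symm
  · exact h₂ h₃

variable [Fintype A] [Nonempty A]

lemma bestScore_nonneg (hw : w ∈ Icc (0 : ℝ) 1) (θ : StudentType S A) (s : S) :
    0 ≤ bestScore w θ s := by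
  obtain ⟨a⟩ := ‹Nonempty A›
  exact (score_nonneg hw θ s a).trans
    (Finset.le_sup' (fun a => score w θ s a) (Finset.mem_univ a))

lemma Affords.anti (hP : P s ≤ P' s) (h : Affords w P' θ s) : Affords w P θ s :=
  hP.trans h

/-- Demand depends on the cutoffs only through the schools that can be entered, with and without
deception. -/
lemma demands_congr (h₁ : ∀ t, AffordsHonestly a₀ w P θ t ↔ AffordsHonestly a₀ w P' θ t)
    (h₂ : ∀ t, Affords w P θ t ↔ Affords w P' θ t) :
    Demands a₀ w γ P θ s ↔ Demands a₀ w γ P' θ s := by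
  have h₃ : ∀ t, netUtility a₀ w γ P θ t = netUtility a₀ w γ P' θ t :=
    fun t => netUtility_congr (h₁ t)
  simp only [Demands, Prefers, h₁, h₂, h₃]

/-- Gross substitutes: a type that demands `s` still demands it when the cutoffs of the other
schools go up. -/
lemma Demands.mono (hγ : 0 ≤ γ) (hP : P ≤ P') (hs : P s = P' s)
    (h : Demands a₀ w γ P θ s) : Demands a₀ w γ P' θ s := by
  obtain ⟨h₁, h₂, h₃⟩ := h
  have hH : AffordsHonestly a₀ w P θ s ↔ AffordsHonestly a₀ w P' θ s := by
    simp only [AffordsHonestly, hs]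
  have hN : netUtility a₀ w γ P θ s = netUtility a₀ w γ P' θ s := netUtility_congr hH
  refine ⟨by simpa only [Affords, ← hs] using h₁, hN ▸ h₂, fun t hts ht => ?_⟩
  have hle := netUtility_anti (a₀ := a₀) (w := w) (θ := θ) hγ (hP t)
  rcases h₃ t hts (ht.anti (hP t)) with h | ⟨h, hh, hn⟩
  · exact Or.inl (hN ▸ hle.trans_lt h)
  · have hn' : ¬ AffordsHonestly a₀ w P' θ t := fun h => hn (h.anti (hP t))
    exact Or.inr ⟨(netUtility_congr (iff_of_false hn' hn)).trans (h.trans hN), hH.1 hh, hn'⟩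

lemma Demands.unique (hs : Demands a₀ w γ P θ s) (ht : Demands a₀ w γ P θ t) : s = t := by
  by_contra hst
  exact (hs.2.2 t (Ne.symm hst) ht.1).asymm (ht.2.2 s hst hs.1)

open Classical in
/-- A type with pairwise distinct utilities demands some school as soon as it can afford one with
positive net utility: the lexicographic order on (net utility, entry without deception) has no
ties. -/
lemma exists_demands_iff [Finite S] (hθ : ∀ s t : S, s ≠ t → utility θ s ≠ utility θ t) :
    (∃ s, Demands a₀ w γ P θ s) ↔ ∃ s, Affords w P θ s ∧ 0 < netUtility a₀ w γ P θ s := by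
  refine ⟨fun ⟨s, h⟩ => ⟨s, h.1, h.2.1⟩, fun ⟨r, hr, hr0⟩ => ?_⟩
  let k : S → ℝ ×ₗ ℕ := fun s =>
    toLex (netUtility a₀ w γ P θ s, if AffordsHonestly a₀ w P θ s then 1 else 0)
  obtain ⟨s, hs, hmax⟩ :=
    Set.exists_max_image {s | Affords w P θ s} k (Set.toFinite _) ⟨r, hr⟩
  have hle : ∀ t, Affords w P θ t → netUtility a₀ w γ P θ t ≤ netUtility a₀ w γ P θ s := by
    intro t ht
    rcases Prod.Lex.toLex_le_toLex.1 (hmax t ht) with h | h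
    exacts [h.le, h.1.le]
  refine ⟨s, hs, hr0.trans_le (hle r hr), fun t hts ht => ?_⟩
  rcases Prod.Lex.toLex_le_toLex.1 (hmax t ht) with h | ⟨h, h'⟩
  · exact Or.inl h
  · refine Or.inr ⟨h, ?_⟩
    have := hθ t s hts
    dsimp only at h h'
    by_cases h₁ : AffordsHonestly a₀ w P θ s <;> by_cases h₂ : AffordsHonestly a₀ w P θ t <;>
      simp_all [netUtility]

end Pointwise

/-! ### Measurability and ties -/

section Measurability

variable {a₀ : A} {w γ : ℝ} {η : Measure (StudentType S A)}

lemma continuous_score (s : S) (a : A) :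
    Continuous fun θ : StudentType S A => score w θ s a := by
  unfold score
  fun_prop

lemma measurable_utility (s : S) : Measurable fun θ : StudentType S A => utility θ s := by
  unfold utility
  fun_prop

lemma measurable_score (s : S) (a : A) :
    Measurable fun θ : StudentType S A => score w θ s a := by
  unfold score
  fun_prop

lemma measurableSet_cutoff_le {f : StudentType S A → ℝ} (hf : Measurable f) (c : WithBot ℝ) :
    MeasurableSet {θ | c ≤ ((f θ : ℝ) : WithBot ℝ)} := by
  induction c using WithBot.recBotCoe with
  | bot => simp
  | coe x =>
    simp only [WithBot.coe_le_coe]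
    exact measurableSet_le measurable_const hf

lemma measurableSet_affordsHonestly (P : Cutoffs S) (s : S) :
    MeasurableSet {θ : StudentType S A | AffordsHonestly a₀ w P θ s} :=
  measurableSet_cutoff_le (measurable_score s a₀) (P s)

lemma measurable_netUtility (P : Cutoffs S) (s : S) :
    Measurable fun θ : StudentType S A => netUtility a₀ w γ P θ s := by
  unfold netUtility
  exact Measurable.ite (measurableSet_affordsHonestly P s) (measurable_utility s)
    ((measurable_utility s).sub_const γ)

lemma NoTies.ae_utility_ne [Finite S] (hη : NoTies w η) :
    ∀ᵐ θ ∂η, ∀ s t : S, s ≠ t → utility θ s ≠ utility θ t := by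
  simp only [ae_all_iff]
  intro s t hst
  simpa [ae_iff] using hη.1 s t hst

variable [Fintype A] [Nonempty A]

lemma measurable_bestScore (s : S) :
    Measurable fun θ : StudentType S A => bestScore w θ s := by
  have : (fun θ : StudentType S A => bestScore w θ s) =
      Finset.univ.sup' Finset.univ_nonempty (fun (a : A) θ => score w θ s a) := by
    ext θ
    simp [bestScore, Finset.sup'_apply]
  rw [this]
  exact Finset.measurable_sup' _ fun a _ => measurable_score s a

lemma measurableSet_affords (P : Cutoffs S) (s : S) :
    MeasurableSet {θ : StudentType S A | Affords w P θ s} :=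
  measurableSet_cutoff_le (measurable_bestScore s) (P s)

lemma measurableSet_demands [Finite S] (P : Cutoffs S) (s : S) :
    MeasurableSet {θ : StudentType S A | Demands a₀ w γ P θ s} := by
  have hN := fun t => measurable_netUtility (a₀ := a₀) (w := w) (γ := γ) P t
  have hH := fun t => measurableSet_affordsHonestly (a₀ := a₀) (w := w) P t
  have hA := fun t => measurableSet_affords (A := A) (w := w) P t
  refine (hA s).inter ((measurableSet_lt measurable_const (hN s)).inter ?_)
  have : {θ : StudentType S A | ∀ t, t ≠ s → Affords w P θ t → Prefers a₀ w γ P θ s t} =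
      ⋂ t, ⋂ _ : t ≠ s, {θ | Affords w P θ t}ᶜ ∪
        ({θ | netUtility a₀ w γ P θ t < netUtility a₀ w γ P θ s} ∪
          ({θ | netUtility a₀ w γ P θ t = netUtility a₀ w γ P θ s} ∩
            ({θ | AffordsHonestly a₀ w P θ s} ∩ {θ | AffordsHonestly a₀ w P θ t}ᶜ))) := by
    ext θ
    simp only [Prefers, mem_ofPred_eq, mem_iInter, mem_union, mem_inter_iff, mem_compl_iff,
      imp_iff_not_or]
  change MeasurableSet {θ : StudentType S A | ∀ t, t ≠ s → _ → _}
  rw [this]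
  exact MeasurableSet.iInter fun t => MeasurableSet.iInter fun _ =>
    (hA t).compl.union ((measurableSet_lt (hN t) (hN s)).union
      ((measurableSet_eq_fun (hN t) (hN s)).inter ((hH s).inter (hH t).compl)))

lemma NoTies.ae_bestScore_ne (hη : NoTies w η) (s : S) (x : ℝ) :
    ∀ᵐ θ ∂η, bestScore w θ s ≠ x := by
  have h : ∀ᵐ θ ∂η, ∀ a, score w θ s a ≠ x := by
    rw [ae_all_iff]
    intro a
    simpa [ae_iff] using hη.2 s a x
  filter_upwards [h] with θ hθ hx
  obtain ⟨a, -, ha⟩ :=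
    Finset.exists_mem_eq_sup' Finset.univ_nonempty (fun a : A => score w θ s a)
  exact hθ a (ha.symm.trans hx)

end Measurability

/-! ### Aggregate demand -/

section Aggregate

variable [Fintype A] [Nonempty A] {a₀ : A} {w γ : ℝ} {η : Measure (StudentType S A)}

lemma ae_exists_demands_anti [Finite S] (hγ : 0 ≤ γ) (hη : NoTies w η) {P P' : Cutoffs S} (hP : P ≤ P') :
    ∀ᵐ θ ∂η, (∃ s, Demands a₀ w γ P' θ s) → ∃ s, Demands a₀ w γ P θ s := by
  filter_upwards [hη.ae_utility_ne] with θ hθ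
  rw [exists_demands_iff hθ, exists_demands_iff hθ]
  exact fun ⟨s, h₁, h₂⟩ => ⟨s, h₁.anti (hP s), h₂.trans_le (netUtility_anti hγ (hP s))⟩

lemma aggregateDemand_eq_zero (hw : w ∈ Icc (0 : ℝ) 1) {P : Cutoffs S} {s : S} (hs : 1 < P s) :
    aggregateDemand a₀ w γ η P s = 0 := by
  have : {θ : StudentType S A | Demands a₀ w γ P θ s} = ∅ := by
    refine eq_empty_of_forall_notMem fun θ hθ => hs.not_ge (hθ.1.trans ?_)
    exact WithBot.coe_le_coe.2 (Finset.sup'_le _ _ fun a _ => score_le_one hw θ s a)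
  simp [aggregateDemand, this]

variable [IsProbabilityMeasure η] {P P' : Cutoffs S}

lemma aggregateDemand_mono (hγ : 0 ≤ γ) (hP : P ≤ P') {s : S} (hs : P s = P' s) :
    aggregateDemand a₀ w γ η P s ≤ aggregateDemand a₀ w γ η P' s :=
  measureReal_mono fun _ h => Demands.mono hγ hP hs h

variable [Fintype S]

lemma sum_aggregateDemand (P : Cutoffs S) :
    ∑ s, aggregateDemand a₀ w γ η P s = η.real {θ | ∃ s, Demands a₀ w γ P θ s} := by
  have h : {θ : StudentType S A | ∃ s, Demands a₀ w γ P θ s} =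
      ⋃ s, {θ | Demands a₀ w γ P θ s} := by
    ext; simp
  rw [h, measureReal_iUnion_fintype _ (fun s => measurableSet_demands P s)]
  · rfl
  · intro s t hst
    exact Set.disjoint_left.2 fun θ hs ht => hst (Demands.unique hs ht)

lemma sum_aggregateDemand_anti (hγ : 0 ≤ γ) (hη : NoTies w η) (hP : P ≤ P') :
    ∑ s, aggregateDemand a₀ w γ η P' s ≤ ∑ s, aggregateDemand a₀ w γ η P s := by
  rw [sum_aggregateDemand, sum_aggregateDemand]
  exact ENNReal.toReal_mono (measure_ne_top _ _)
    (measure_mono_ae (ae_exists_demands_anti hγ hη hP))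

/-- Away from the null set of types with a score equal to a cutoff, demand is locally constant in
the cutoffs; dominated convergence does the rest. -/
lemma continuous_demandMap (hη : NoTies w η) : Continuous (demandMap a₀ w γ η) := by
  refine continuous_pi fun s => continuous_iff_continuousAt.2 fun P => ?_
  have key : ∀ᵐ θ ∂η, ∀ᶠ P' : S → ℝ in 𝓝 P,
      (Demands a₀ w γ (fun t => ((P' t : ℝ) : WithBot ℝ)) θ s ↔
        Demands a₀ w γ (fun t => ((P t : ℝ) : WithBot ℝ)) θ s) := by
    have h₁ : ∀ᵐ θ ∂η, ∀ t, score w θ t a₀ ≠ P t := by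
      rw [ae_all_iff]
      intro t
      simpa [ae_iff] using hη.2 t a₀ (P t)
    have h₂ : ∀ᵐ θ ∂η, ∀ t, bestScore w θ t ≠ P t :=
      ae_all_iff.2 fun t => hη.ae_bestScore_ne t (P t)
    have loc : ∀ (t : S) (x : ℝ), x ≠ P t → ∀ᶠ P' : S → ℝ in 𝓝 P, (P' t ≤ x ↔ P t ≤ x) := by
      intro t x hx
      have hc : Tendsto (fun P' : S → ℝ => P' t) (𝓝 P) (𝓝 (P t)) :=
        (continuous_apply t).continuousAt
      rcases lt_or_gt_of_ne hx with h | h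
      · filter_upwards [hc.eventually (lt_mem_nhds h)] with P' h'
        exact iff_of_false h'.not_ge h.not_ge
      · filter_upwards [hc.eventually (gt_mem_nhds h)] with P' h'
        exact iff_of_true h'.le h.le
    filter_upwards [h₁, h₂] with θ hθ₁ hθ₂
    filter_upwards [eventually_all.2 fun t => loc t _ (hθ₁ t),
      eventually_all.2 fun t => loc t _ (hθ₂ t)] with P' hP₁ hP₂
    exact demands_congr (fun t => by simpa [AffordsHonestly] using hP₁ t)
      (fun t => by simpa [Affords] using hP₂ t)
  have hm := tendsto_measure_of_ae_tendsto_indicator_of_isFiniteMeasure (μ := η) (𝓝 P)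
    (A := {θ | Demands a₀ w γ (fun t => ((P t : ℝ) : WithBot ℝ)) θ s})
    (As := fun P' : S → ℝ => {θ | Demands a₀ w γ (fun t => ((P' t : ℝ) : WithBot ℝ)) θ s})
    (measurableSet_demands _ s) (fun _ => measurableSet_demands _ s) key
  exact (ENNReal.tendsto_toReal (measure_ne_top _ _)).comp hm

/-- The demand for the schools in `U`, as a function of the demand for the schools in `R`, is
`1`-Lipschitz when only the cutoffs of `R` vary: demand that leaves `R` is the only source of
additional demand elsewhere. -/
lemma sum_aggregateDemand_le (hγ : 0 ≤ γ) (hη : NoTies w η) {U R : Finset S}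
    (hUR : Disjoint U R) (hP : ∀ s ∉ R, P s = P' s) :
    ∑ s ∈ U, aggregateDemand a₀ w γ η P s ≤ ∑ s ∈ U, aggregateDemand a₀ w γ η P' s +
      ∑ r ∈ R, |aggregateDemand a₀ w γ η P r - aggregateDemand a₀ w γ η P' r| := by
  classical
  set D := aggregateDemand a₀ w γ η with hD
  have hout : ∀ s ∉ R, D P s ≤ D (P ⊔ P') s ∧ D P' s ≤ D (P ⊔ P') s := fun s hs =>
    ⟨aggregateDemand_mono hγ le_sup_left (by simp [hP s hs]),
      aggregateDemand_mono hγ le_sup_right (by simp [hP s hs])⟩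
  have hin : ∀ s, D P' s - |D P s - D P' s| ≤ D (P ⊔ P') s := by
    intro s
    rcases le_total (P s) (P' s) with h | h
    · have : D P' s ≤ D (P ⊔ P') s := aggregateDemand_mono hγ le_sup_right (by simp [h])
      linarith [abs_nonneg (D P s - D P' s)]
    · have : D P s ≤ D (P ⊔ P') s := aggregateDemand_mono hγ le_sup_left (by simp [h])
      linarith [neg_abs_le (D P s - D P' s)]
  have htot : ∑ s, D (P ⊔ P') s ≤ ∑ s, D P' s := sum_aggregateDemand_anti hγ hη le_sup_right
  have hU : U ⊆ Rᶜ := fun s hs => Finset.mem_compl.2 (Finset.disjoint_left.1 hUR hs)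
  rw [← Finset.sum_add_sum_compl R, ← Finset.sum_add_sum_compl R (D P'),
    ← Finset.sum_sdiff hU, ← Finset.sum_sdiff hU] at htot
  have h₁ : ∑ s ∈ U, D P s ≤ ∑ s ∈ U, D (P ⊔ P') s :=
    Finset.sum_le_sum fun s hs => (hout s (Finset.disjoint_left.1 hUR hs)).1
  have h₂ : ∑ s ∈ Rᶜ \ U, D P' s ≤ ∑ s ∈ Rᶜ \ U, D (P ⊔ P') s :=
    Finset.sum_le_sum fun s hs =>
      (hout s (Finset.mem_compl.1 (Finset.mem_sdiff.1 hs).1)).2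
  have h₃ : ∑ s ∈ R, (D P' s - |D P s - D P' s|) ≤ ∑ s ∈ R, D (P ⊔ P') s :=
    Finset.sum_le_sum fun s _ => hin s
  rw [Finset.sum_sub_distrib] at h₃
  linarith

end Aggregate

/-! ### Existence of market-clearing cutoffs -/

section Equilibrium

variable [Fintype S] [Fintype A] [Nonempty A] {a₀ : A} {w γ : ℝ}
  {η : Measure (StudentType S A)} [IsProbabilityMeasure η] {C : S → ℝ} {P P' : Cutoffs S}

/-- The cutoffs with minimal sum among the nonnegative cutoffs without excess demand clear the
market once each cutoff `0` is replaced by `⊥`: a positive cutoff with excess supply could be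
lowered a little, which by gross substitutes creates no excess demand elsewhere. -/
theorem exists_marketClearing (hw : w ∈ Icc (0 : ℝ) 1) (hγ : 0 ≤ γ) (hη : NoTies w η)
    (hC : ∀ s, 0 < C s) : ∃ P, MarketClearing a₀ w γ η C P := by
  classical
  have hcont := continuous_demandMap (a₀ := a₀) (γ := γ) hη
  let K : Set (S → ℝ) := Icc 0 2 ∩ demandMap a₀ w γ η ⁻¹' Iic C
  have hK : IsCompact K := isCompact_Icc.inter_right (isClosed_Iic.preimage hcont)
  have hne : K.Nonempty := by
    refine ⟨2, ⟨fun s => zero_le_two, le_rfl⟩, fun s => ?_⟩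
    have h2 : (1 : WithBot ℝ) < ((2 : ℝ) : WithBot ℝ) := WithBot.coe_lt_coe.2 one_lt_two
    have h0 : demandMap a₀ w γ η 2 s = 0 :=
      aggregateDemand_eq_zero (P := fun _ => ((2 : ℝ) : WithBot ℝ)) hw h2
    exact h0.trans_le (hC s).le
  obtain ⟨p, ⟨⟨hp0, hp2⟩, hpC⟩, hmin⟩ := hK.exists_isMinOn hne
    (f := fun p : S → ℝ => ∑ s, p s) (by fun_prop)
  have heq : ∀ s, p s ≠ 0 → demandMap a₀ w γ η p s = C s := by
    intro s hs
    by_contra hlt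
    replace hlt : demandMap a₀ w γ η p s < C s := lt_of_le_of_ne (hpC s) hlt
    have hps : 0 < p s := lt_of_le_of_ne (hp0 s) (Ne.symm hs)
    have hc : Tendsto (fun x : ℝ => demandMap a₀ w γ η (Function.update p s x) s) (𝓝[<] (p s))
        (𝓝 (demandMap a₀ w γ η p s)) := by
      have : Continuous fun x : ℝ => demandMap a₀ w γ η (Function.update p s x) s :=
        (continuous_apply s).comp (hcont.comp (continuous_const.update s continuous_id))
      simpa using (this.tendsto (p s)).mono_left nhdsWithin_le_nhds
    obtain ⟨x, hxC, hx0, hxp⟩ := ((hc.eventually (gt_mem_nhds hlt)).and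
      (Ioo_mem_nhdsLT hps)).exists
    have hup : Function.update p s x ≤ p := update_le_self_iff.2 hxp.le
    have hmem : Function.update p s x ∈ K := by
      refine ⟨⟨le_update_iff.2 ⟨hx0.le, fun t _ => hp0 t⟩, hup.trans hp2⟩, fun t => ?_⟩
      by_cases hts : t = s
      · subst hts
        exact hxC.le
      · refine le_trans ?_ (hpC t)
        refine aggregateDemand_mono hγ (fun r => WithBot.coe_le_coe.2 (hup r)) ?_
        simp [hts]
    have hsum : ∑ t, Function.update p s x t < ∑ t, p t :=
      Finset.sum_lt_sum (fun t _ => hup t) ⟨s, Finset.mem_univ s, by simpa using hxp⟩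
    exact hsum.not_ge (hmin hmem)
  let Q : Cutoffs S := fun s => if p s = 0 then ⊥ else ((p s : ℝ) : WithBot ℝ)
  have hQ : ∀ s, aggregateDemand a₀ w γ η Q s = demandMap a₀ w γ η p s := by
    have hle : ∀ (s : S) (x : ℝ), 0 ≤ x →
        (Q s ≤ (x : WithBot ℝ) ↔ ((p s : ℝ) : WithBot ℝ) ≤ (x : WithBot ℝ)) := by
      intro s x hx
      by_cases h : p s = 0
      · simpa [Q, h] using WithBot.coe_le_coe.2 hx
      · simp [Q, h]
    intro s
    unfold demandMap aggregateDemand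
    congr 1
    ext θ
    exact demands_congr (fun t => hle t _ (score_nonneg hw θ t a₀))
      (fun t => hle t _ (bestScore_nonneg hw θ t))
  refine ⟨Q, fun s => (hQ s).trans_le (hpC s), fun s hs => (hQ s).trans (heq s fun h => ?_)⟩
  simp [Q, h] at hs

/-! ### Uniqueness of market-clearing cutoffs -/

/-- All market-clearing cutoffs, and their joins, fill every school to the same extent. -/
lemma MarketClearing.aggregateDemand_sup (hγ : 0 ≤ γ) (hη : NoTies w η)
    (h : MarketClearing a₀ w γ η C P) (h' : MarketClearing a₀ w γ η C P') (s : S) :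
    aggregateDemand a₀ w γ η (P ⊔ P') s = aggregateDemand a₀ w γ η P s := by
  have hle : ∀ s ∈ Finset.univ,
      aggregateDemand a₀ w γ η P s ≤ aggregateDemand a₀ w γ η (P ⊔ P') s := by
    intro s _
    rcases le_or_gt (P' s) (P s) with hs | hs
    · exact aggregateDemand_mono hγ le_sup_left (by simp [hs])
    · refine (h.1 s).trans ((h'.2 s (bot_le.trans_lt hs)).symm.le.trans ?_)
      exact aggregateDemand_mono hγ le_sup_right (by simp [hs.le])
  have hsum := (Finset.sum_le_sum hle).antisymm (sum_aggregateDemand_anti hγ hη le_sup_left)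
  exact ((Finset.sum_eq_sum_iff_of_le hle).1 hsum s (Finset.mem_univ s)).symm

lemma MarketClearing.sup (hγ : 0 ≤ γ) (hη : NoTies w η)
    (h : MarketClearing a₀ w γ η C P) (h' : MarketClearing a₀ w γ η C P') :
    MarketClearing a₀ w γ η C (P ⊔ P') := by
  refine ⟨fun s => (h.aggregateDemand_sup hγ hη h' s).trans_le (h.1 s), fun s hs => ?_⟩
  rcases lt_sup_iff.1 hs with hs | hs
  · exact (h.aggregateDemand_sup hγ hη h' s).trans (h.2 s hs)
  · rw [sup_comm]
    exact (h'.aggregateDemand_sup hγ hη h s).trans (h'.2 s hs)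

/-- If the cutoff of `s` differs between `P ≤ P'` by more than the identification of nonpositive
cutoffs, an open set of types that accept only `s` is matched at `P` and not at `P'`, although
both fill the same seats. -/
lemma MarketClearing.sameCutoffs_of_le (hw : w ∈ Icc (0 : ℝ) 1) (hγ : 0 ≤ γ)
    (hη : NoTies w η) (hfull : FullSupport η) (hC : ∀ s, 0 < C s)
    (h : MarketClearing a₀ w γ η C P) (h' : MarketClearing a₀ w γ η C P') (hP : P ≤ P') :
    SameCutoffs P P' := by
  classical
  intro s
  by_contra! hs
  obtain ⟨hne, hpos⟩ := hs
  have hlt : P s < P' s := lt_of_le_of_ne (hP s) hne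
  have hpos' : 0 < P' s := by
    by_contra! hle
    exact (hpos (hlt.le.trans hle)).not_ge hle
  have hone : P' s ≤ 1 := by
    by_contra! hgt
    exact (hC s).ne' ((h'.2 s (bot_le.trans_lt hlt)).symm.trans (aggregateDemand_eq_zero hw hgt))
  obtain ⟨y, hyP, hyP'⟩ := exists_between (max_lt hlt hpos')
  obtain ⟨c, hyc, hcP'⟩ := exists_between hyP'
  lift y to ℝ using ((bot_le.trans_lt hyP).ne')
  lift c to ℝ using ((bot_le.trans_lt hyc).ne')
  lift P' s to ℝ using ((bot_le.trans_lt hlt).ne') with x hx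
  have hyc : y < c := WithBot.coe_lt_coe.1 hyc
  have hcx : c < x := WithBot.coe_lt_coe.1 hcP'
  have hx1 : x ≤ 1 := WithBot.coe_le_coe.1 hone
  have hy0 : 0 < y := WithBot.coe_lt_coe.1 ((le_max_right _ _).trans_lt hyP)
  have hPy : P s < (y : WithBot ℝ) := (le_max_left _ _).trans_lt hyP
  let V : Set (StudentType S A) :=
    {θ | γ < utility θ s} ∩ ((⋂ t, ⋂ _ : t ≠ s, {θ | utility θ t < 0}) ∩
      ⋂ a, {θ | score w θ s a ∈ Ioo y x})
  have hVo : IsOpen V := by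
    have hu : ∀ t, Continuous fun θ : StudentType S A => utility θ t := by
      intro t
      unfold utility
      fun_prop
    refine (isOpen_lt continuous_const (hu s)).inter (IsOpen.inter ?_ ?_)
    · exact isOpen_iInter_of_finite fun t => isOpen_iInter_of_finite fun _ =>
        isOpen_lt (hu t) continuous_const
    · exact isOpen_iInter_of_finite fun a => isOpen_Ioo.preimage (continuous_score s a)
  have hVne : V.Nonempty := by
    let c' : unitInterval := ⟨c, by linarith, by linarith⟩
    refine ⟨(fun t => if t = s then γ + 1 else -1, fun _ _ => c', fun _ => c'), ?_, ?_, ?_⟩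
    · simp [utility]
    · simp +contextual [utility]
    · have hc : w * c + (1 - w) * c = c := by ring
      simp [score, c', hc, hyc, hcx]
  have hVm : MeasurableSet V := by
    refine (measurableSet_lt measurable_const (measurable_utility s)).inter
      (MeasurableSet.inter ?_ ?_)
    · exact MeasurableSet.iInter fun t => MeasurableSet.iInter fun _ =>
        measurableSet_lt (measurable_utility t) measurable_const
    · exact MeasurableSet.iInter fun a => measurableSet_Ioo.preimage (measurable_score s a)
  have hsub : ∀ᵐ θ ∂η, (θ ∈ V ∨ ∃ t, Demands a₀ w γ P' θ t) → ∃ t, Demands a₀ w γ P θ t := by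
    filter_upwards [hη.ae_utility_ne, ae_exists_demands_anti (a₀ := a₀) hγ hη hP]
      with θ hθ hanti
    rintro (⟨hs, -, ha⟩ | hd)
    · rw [exists_demands_iff hθ]
      refine ⟨s, ?_, (sub_pos.2 hs).trans_le (le_netUtility hγ)⟩
      refine hPy.le.trans (WithBot.coe_le_coe.2 ?_)
      exact (mem_iInter.1 ha a₀).1.le.trans
        (Finset.le_sup' (fun a => score w θ s a) (Finset.mem_univ a₀))
    · exact hanti hd
  have hdisj : Disjoint {θ | ∃ t, Demands a₀ w γ P' θ t} V := by
    refine Set.disjoint_left.2 ?_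
    rintro θ ⟨t, ht⟩ ⟨-, hneg, ha⟩
    by_cases hts : t = s
    · subst hts
      have haf : P' t ≤ ((bestScore w θ t : ℝ) : WithBot ℝ) := ht.1
      rw [← hx, WithBot.coe_le_coe] at haf
      exact haf.not_gt ((Finset.sup'_lt_iff _).2 fun a _ => (mem_iInter.1 ha a).2)
    · have := mem_iInter.1 (mem_iInter.1 hneg t) hts
      exact (ht.2.1.trans_le (netUtility_le hγ)).not_gt this
  have hmass : η.real {θ | ∃ t, Demands a₀ w γ P' θ t} + η.real V ≤
      η.real {θ | ∃ t, Demands a₀ w γ P θ t} := by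
    rw [← measureReal_union hdisj hVm]
    refine ENNReal.toReal_mono (measure_ne_top _ _) (measure_mono_ae ?_)
    filter_upwards [hsub] with θ hθ hmem
    exact hθ hmem.symm
  have heq : ∑ t, aggregateDemand a₀ w γ η P' t = ∑ t, aggregateDemand a₀ w γ η P t :=
    Finset.sum_congr rfl fun t _ => by
      simpa [sup_eq_right.2 hP] using h.aggregateDemand_sup hγ hη h' t
  rw [sum_aggregateDemand, sum_aggregateDemand] at heq
  have hV0 : 0 < η.real V := ENNReal.toReal_pos (hfull V hVo hVne).ne' (measure_ne_top _ _)
  linarith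

theorem MarketClearing.sameCutoffs (hw : w ∈ Icc (0 : ℝ) 1) (hγ : 0 ≤ γ)
    (hη : NoTies w η) (hfull : FullSupport η) (hC : ∀ s, 0 < C s)
    (h : MarketClearing a₀ w γ η C P) (h' : MarketClearing a₀ w γ η C P') :
    SameCutoffs P P' := by
  have h₁ := h.sameCutoffs_of_le hw hγ hη hfull hC (h.sup hγ hη h') le_sup_left
  have h₂ := h'.sameCutoffs_of_le hw hγ hη hfull hC (h.sup hγ hη h') le_sup_right
  intro s
  rcases h₁ s with h₁ | h₁ <;> rcases h₂ s with h₂ | h₂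
  · exact Or.inl (h₁.trans h₂.symm)
  · exact Or.inr ⟨h₁.trans_le h₂.2, h₂.1⟩
  · exact Or.inr ⟨h₁.1, h₂.trans_le h₁.2⟩
  · exact Or.inr ⟨h₁.1, h₂.1⟩

end Equilibrium

/-! ### Uniqueness for almost every capacity vector -/

section Generic

/-- A set on which the sum of the coordinates in `U` is a Lipschitz function of the coordinates in
`R` is null: so is its closure, which meets each line parallel to an axis of `U` at most once. -/
lemma volume_eq_zero_of_abs_sum_sub_le [Fintype S] {U R : Finset S} (hU : U.Nonempty)
    (hUR : Disjoint U R) {B : Set (S → ℝ)}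
    (hB : ∀ x ∈ B, ∀ y ∈ B, |∑ s ∈ U, x s - ∑ s ∈ U, y s| ≤ ∑ r ∈ R, |x r - y r|) :
    volume B = 0 := by
  classical
  have hcl : ∀ x ∈ closure B, ∀ y ∈ closure B,
      |∑ s ∈ U, x s - ∑ s ∈ U, y s| ≤ ∑ r ∈ R, |x r - y r| := by
    have hclosed : IsClosed {z : (S → ℝ) × (S → ℝ) |
        |∑ s ∈ U, z.1 s - ∑ s ∈ U, z.2 s| ≤ ∑ r ∈ R, |z.1 r - z.2 r|} :=
      isClosed_le (by fun_prop) (by fun_prop)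
    intro x hx y hy
    have hxy : (x, y) ∈ closure (B ×ˢ B) := by
      rw [closure_prod_eq]
      exact ⟨hx, hy⟩
    exact closure_minimal (fun z hz => hB z.1 hz.1 z.2 hz.2) hclosed hxy
  obtain ⟨u, hu⟩ := hU
  refine measure_mono_null subset_closure ?_
  refine Measure.addHaar_eq_zero_of_disjoint_translates volume
    (u := fun n : ℕ => Pi.single u (1 / ((n : ℝ) + 1))) ?_ ?_ isClosed_closure.measurableSet
  · refine (Metric.isBounded_Icc (0 : S → ℝ) 1).subset ?_
    rintro _ ⟨n, rfl⟩
    have h1 : 1 / ((n : ℝ) + 1) ≤ 1 := by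
      rw [div_le_one (by positivity)]
      linarith [Nat.cast_nonneg (α := ℝ) n]
    refine ⟨Pi.single_nonneg.2 (by positivity), fun t => ?_⟩
    by_cases ht : t = u
    · subst ht
      simpa using h1
    · simp [ht]
  · intro m n hmn
    refine Set.disjoint_left.2 fun z hm hn => hmn ?_
    simp only [singleton_add, mem_image] at hm hn
    obtain ⟨x, hx, rfl⟩ := hm
    obtain ⟨y, hy, hxy⟩ := hn
    have hs : ∀ s, y s - x s = if s = u then 1 / ((m : ℝ) + 1) - 1 / ((n : ℝ) + 1) else 0 := by
      intro s
      have := congrFun hxy s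
      simp only [Pi.add_apply, Pi.single_apply] at this
      split_ifs at this ⊢ <;> linarith
    have hR : ∑ r ∈ R, |y r - x r| = 0 := Finset.sum_eq_zero fun r hr => by
      have hru : r ≠ u := by
        rintro rfl
        exact Finset.disjoint_left.1 hUR hu hr
      rw [hs, if_neg hru, abs_zero]
    have hle := hcl y hy x hx
    rw [hR, ← Finset.sum_sub_distrib, Finset.sum_congr rfl fun s _ => hs s,
      Finset.sum_ite_eq' U u, if_pos hu] at hle
    have h0 := sub_eq_zero.1 (abs_nonpos_iff.1 hle)
    have := inv_injective (by simpa using h0 : ((m : ℝ) + 1)⁻¹ = ((n : ℝ) + 1)⁻¹)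
    exact_mod_cast add_right_cancel this

variable [Fintype S] [Fintype A] [Nonempty A] {a₀ : A} {w γ : ℝ}
  {η : Measure (StudentType S A)} [IsProbabilityMeasure η] {C : S → ℝ} {P P' : Cutoffs S}

/-- The capacities `C` for which some cutoffs, prescribed by `q` outside `R`, fill exactly the
schools in `R` one by one and those in `U` in total. -/
def exactlyFilled (a₀ : A) (w γ : ℝ) (η : Measure (StudentType S A)) (U R : Finset S)
    (q : S → WithBot ℚ) : Set (S → ℝ) :=
  {C | ∃ P : Cutoffs S, (∀ s ∉ R, P s = (q s).map (fun x : ℚ => (x : ℝ))) ∧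
    (∀ r ∈ R, aggregateDemand a₀ w γ η P r = C r) ∧
    ∑ s ∈ U, aggregateDemand a₀ w γ η P s = ∑ s ∈ U, C s}

lemma volume_exactlyFilled (hγ : 0 ≤ γ) (hη : NoTies w η) {U R : Finset S} (hU : U.Nonempty)
    (hUR : Disjoint U R) (q : S → WithBot ℚ) :
    volume (exactlyFilled a₀ w γ η U R q) = 0 := by
  refine volume_eq_zero_of_abs_sum_sub_le hU hUR ?_
  rintro C ⟨P, hPq, hPR, hPU⟩ C' ⟨P', hPq', hPR', hPU'⟩
  have hPP : ∀ s ∉ R, P s = P' s := fun s hs => (hPq s hs).trans (hPq' s hs).symm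
  have h₁ := sum_aggregateDemand_le (a₀ := a₀) hγ hη hUR hPP
  have h₂ := sum_aggregateDemand_le (a₀ := a₀) hγ hη hUR fun s hs => (hPP s hs).symm
  have h₃ : ∑ r ∈ R, |aggregateDemand a₀ w γ η P r - aggregateDemand a₀ w γ η P' r| =
      ∑ r ∈ R, |C r - C' r| :=
    Finset.sum_congr rfl fun r hr => by rw [hPR r hr, hPR' r hr]
  have h₄ : ∑ r ∈ R, |aggregateDemand a₀ w γ η P' r - aggregateDemand a₀ w γ η P r| =
      ∑ r ∈ R, |C r - C' r| :=
    Finset.sum_congr rfl fun r hr => by rw [hPR r hr, hPR' r hr, abs_sub_comm]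
  rw [hPU, hPU', h₃] at h₁
  rw [hPU, hPU', h₄] at h₂
  exact abs_sub_le_iff.2 ⟨by linarith, by linarith⟩

/-- Between two comparable market-clearing vectors there are rational cutoffs, on the set `U` of
schools where the two vectors differ, which leave the demand for each other school and the total
demand for `U` unchanged. -/
lemma MarketClearing.mem_exactlyFilled (hγ : 0 ≤ γ) (hη : NoTies w η)
    (h : MarketClearing a₀ w γ η C P) (h' : MarketClearing a₀ w γ η C P') (hlt : P < P') :
    ∃ (U R : Finset S) (q : S → WithBot ℚ), U.Nonempty ∧ Disjoint U R ∧
      C ∈ exactlyFilled a₀ w γ η U R q := by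
  classical
  have hP : P ≤ P' := hlt.le
  have hDD : ∀ s, aggregateDemand a₀ w γ η P' s = aggregateDemand a₀ w γ η P s := fun s => by
    simpa [sup_eq_right.2 hP] using h.aggregateDemand_sup hγ hη h' s
  have hq : ∀ s, ∃ x : ℚ, P s < P' s →
      P s ≤ ((x : ℝ) : WithBot ℝ) ∧ ((x : ℝ) : WithBot ℝ) ≤ P' s := by
    intro s
    by_cases hs : P s < P' s
    · obtain ⟨y, hy, hyP'⟩ := exists_between hs
      obtain ⟨z, hyz, hzP'⟩ := exists_between hyP'
      lift y to ℝ using ((bot_le.trans_lt hy).ne')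
      lift z to ℝ using ((bot_le.trans_lt hyz).ne')
      obtain ⟨x, hyx, hxz⟩ := exists_rat_btwn (WithBot.coe_lt_coe.1 hyz)
      exact ⟨x, fun _ => ⟨hy.le.trans (WithBot.coe_le_coe.2 hyx.le),
        (WithBot.coe_le_coe.2 hxz.le).trans hzP'.le⟩⟩
    · exact ⟨0, fun h => absurd h hs⟩
  choose x hx using hq
  let U : Finset S := Finset.univ.filter fun s => P s < P' s
  let R : Finset S := Finset.univ.filter fun s => P s = P' s ∧ P s ≠ ⊥
  let Z : Cutoffs S := fun s => if P s < P' s then ((x s : ℝ) : WithBot ℝ) else P s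
  have hPZ : P ≤ Z := fun s => by
    by_cases hs : P s < P' s
    · simpa [Z, hs] using (hx s hs).1
    · simp [Z, hs]
  have hZP' : Z ≤ P' := fun s => by
    by_cases hs : P s < P' s
    · simpa [Z, hs] using (hx s hs).2
    · simpa [Z, hs] using hP s
  have hout : ∀ s, s ∉ U → aggregateDemand a₀ w γ η Z s = aggregateDemand a₀ w γ η P s := by
    intro s hs
    have hs : ¬ P s < P' s := by simpa [U] using hs
    have hPs : P s = P' s := eq_of_le_of_not_lt (hP s) hs
    have hZs : Z s = P s := by simp [Z, hs]
    exact ((aggregateDemand_mono hγ hZP' (hZs.trans hPs)).trans (hDD s).le).antisymm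
      (aggregateDemand_mono hγ hPZ hZs.symm)
  have htot : ∑ s, aggregateDemand a₀ w γ η Z s = ∑ s, aggregateDemand a₀ w γ η P s := by
    refine (sum_aggregateDemand_anti hγ hη hPZ).antisymm ?_
    rw [← Finset.sum_congr rfl fun s _ => hDD s]
    exact sum_aggregateDemand_anti hγ hη hZP'
  refine ⟨U, R, fun s => if P s < P' s then ((x s : ℚ) : WithBot ℚ) else ⊥, ?_, ?_,
    Z, ?_, ?_, ?_⟩
  · obtain ⟨s, hs⟩ := (Pi.lt_def.1 hlt).2
    exact ⟨s, by simpa [U] using hs⟩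
  · refine Finset.disjoint_left.2 fun s hsU hsR => ?_
    simp only [U, R, Finset.mem_filter, Finset.mem_univ, true_and] at hsU hsR
    exact hsU.ne hsR.1
  · intro s hs
    simp only [R, Finset.mem_filter, Finset.mem_univ, true_and, not_and, not_not] at hs
    by_cases hlt : P s < P' s
    · simp [Z, hlt]
    · have hb : P s = ⊥ := hs (eq_of_le_of_not_lt (hP s) hlt)
      simp only [Z, if_neg hlt, WithBot.map_bot]
      exact hb
  · intro r hr
    simp only [R, Finset.mem_filter, Finset.mem_univ, true_and] at hr
    rw [hout r (by simp [U, hr.1]), h.2 r (bot_lt_iff_ne_bot.2 hr.2)]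
  · rw [← Finset.sum_add_sum_compl U, ← Finset.sum_add_sum_compl U,
      Finset.sum_congr rfl fun s hs => hout s (Finset.mem_compl.1 hs)] at htot
    rw [add_right_cancel htot]
    refine Finset.sum_congr rfl fun s hs => ?_
    simp only [U, Finset.mem_filter, Finset.mem_univ, true_and] at hs
    rw [← hDD s, h'.2 s (bot_le.trans_lt hs)]

theorem ae_marketClearing_unique (hγ : 0 ≤ γ) (hη : NoTies w η) :
    ∀ᵐ C ∂(volume : Measure (S → ℝ)), ∀ P P', MarketClearing a₀ w γ η C P →
      MarketClearing a₀ w γ η C P' → P = P' := by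
  have : Countable (WithBot ℚ) := inferInstanceAs (Countable (Option ℚ))
  have hnull : ∀ᵐ C ∂(volume : Measure (S → ℝ)), ∀ (U R : Finset S) (q : S → WithBot ℚ),
      U.Nonempty → Disjoint U R → C ∉ exactlyFilled a₀ w γ η U R q := by
    simp only [ae_all_iff]
    intro U R q hU hUR
    exact measure_eq_zero_iff_ae_notMem.1 (volume_exactlyFilled hγ hη hU hUR q)
  filter_upwards [hnull] with C hC P P' h h'
  have hmax : ∀ Q, MarketClearing a₀ w γ η C Q → Q ≤ P ⊔ P' → Q = P ⊔ P' := by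
    intro Q hQ hle
    by_contra hne
    obtain ⟨U, R, q, hU, hUR, hmem⟩ :=
      hQ.mem_exactlyFilled hγ hη (h.sup hγ hη h') (lt_of_le_of_ne hle hne)
    exact hC U R q hU hUR hmem
  exact (hmax P h le_sup_left).trans (hmax P' h' le_sup_right).symm

end Generic

end Deception

end

theorem theorem1 {S A : Type*} [Fintype S] [Fintype A] [Nontrivial A] (a₀ : A)
    (w γ : ℝ) (hw : w ∈ Set.Icc (0 : ℝ) 1) (hγ : 0 < γ)
    (η : Measure (Deception.StudentType S A)) [IsProbabilityMeasure η]
    (hη : Deception.NoTies w η) :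
    (Deception.FullSupport η →
      ∀ C : S → ℝ, (∀ s, 0 < C s) →
        (∃ P, Deception.MarketClearing a₀ w γ η C P) ∧
          ∀ P P', Deception.MarketClearing a₀ w γ η C P →
            Deception.MarketClearing a₀ w γ η C P' → Deception.SameCutoffs P P') ∧
    (Deception.Regular a₀ w γ η →
      ∀ᵐ C ∂(volume : Measure (S → ℝ)), (∀ s, 0 < C s) → ∑ s, C s < 1 →
        ∃! P, Deception.MarketClearing a₀ w γ η C P) := by
  refine ⟨fun hfull C hC => ⟨Deception.exists_marketClearing hw hγ.le hη hC, fun P P' h h' =>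
    h.sameCutoffs hw hγ.le hη hfull hC h'⟩, fun _ => ?_⟩
  filter_upwards [Deception.ae_marketClearing_unique (a₀ := a₀) hγ.le hη] with C huniq hC _
  obtain ⟨P, hP⟩ := Deception.exists_marketClearing (a₀ := a₀) hw hγ.le hη hC
  exact ⟨P, hP, fun P' hP' => huniq P' P hP' hP⟩
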